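/- Let $p$ be a prime, $k$ a field of characteristic $p$, and $G$ a group of order $p^n$ whose Frattini subgroup $\Phi(G)$ has order $p$. Let $t(G)$ denote the nilpotency index of the Jacobson radical $J(kG)$ of the group algebra $kG$, that is, the smallest positive integer $s$ such that $J(kG)^s = 0$. Then the exponent of $G$ is $p$ or $p^2$, and \[ t(G) = \begin{cases} (n+1)(p-1)+1 & \text{if $G$ has exponent $p$,} \\ (p+n-1)(p-1)+1 & \text{if $G$ has exponent $p^2$.} \end{cases} \] In particular, if $p=2$ then $t(G)=n+2$. -/

import Mathlib

/-- The nilpotency index of the Jacobson radical of a ring `A`: the smallest positive integer `s`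
with `J(A) ^ s = 0`. (It is `0` if the radical is not nilpotent.) -/
noncomputable def radicalNilpotencyIndex (A : Type*) [Ring A] : ℕ :=
  sInf {s : ℕ | 0 < s ∧ Ring.jacobson A ^ s = ⊥}

/-- `t(G)`, relative to a coefficient field `k`: the nilpotency index of the Jacobson radical
of the group algebra `kG`. -/
noncomputable def groupNilpotencyIndex (k G : Type*) [Field k] [Group G] : ℕ :=
  radicalNilpotencyIndex (MonoidAlgebra k G)

section FrattiniPGroup

variable {p n : ℕ} [Fact p.Prime] {G : Type*} [Group G]

theorem index_eq_of_isCoatom (hG : Nat.card G = p ^ n) {M : Subgroup G} (hM : IsCoatom M) :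
    M.index = p := by
  have hp : p.Prime := Fact.out
  have : Finite G := Nat.finite_of_card_ne_zero (by rw [hG]; exact pow_ne_zero _ hp.ne_zero)
  obtain ⟨m, hmn, hm⟩ := (Nat.dvd_prime_pow hp).1 (hG ▸ M.card_subgroup_dvd_card)
  have hlt : m < n := by
    refine lt_of_le_of_ne hmn fun h => hM.1 ?_
    exact Subgroup.eq_top_of_card_eq M (by rw [hm, hG, h])
  obtain ⟨K, hK, hMK⟩ := Sylow.exists_subgroup_card_pow_succ
    (hG ▸ pow_dvd_pow p (Nat.succ_le_of_lt hlt)) hm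
  have hKtop : K = ⊤ := hM.2 K (lt_of_le_of_ne hMK fun h => by
    rw [← h, hm] at hK
    exact absurd (Nat.pow_right_injective hp.two_le hK) (by omega))
  rw [hKtop, Subgroup.card_top, ← M.card_mul_index, hm, pow_succ] at hK
  exact Nat.eq_of_mul_eq_mul_left (pow_pos hp.pos m) hK

theorem normal_of_isCoatom (hG : Nat.card G = p ^ n) {M : Subgroup G} (hM : IsCoatom M) :
    M.Normal := by
  have hp : p.Prime := Fact.out
  have : Finite G := Nat.finite_of_card_ne_zero (by rw [hG]; exact pow_ne_zero _ hp.ne_zero)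
  have := (IsPGroup.of_card hG).isNilpotent
  exact Subgroup.NormalizerCondition.normal_of_coatom _ Group.normalizerCondition_of_isNilpotent hM

theorem mem_frattini_iff {g : G} : g ∈ frattini G ↔ ∀ M : Subgroup G, IsCoatom M → g ∈ M := by
  simp [frattini, Order.radical, Subgroup.mem_iInf]

theorem pow_mem_frattini (hG : Nat.card G = p ^ n) (g : G) : g ^ p ∈ frattini G := by
  refine mem_frattini_iff.2 fun M hM => ?_
  have := normal_of_isCoatom hG hM
  have h := index_eq_of_isCoatom hG hM
  rw [← h]
  exact M.pow_index_mem g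

open scoped commutatorElement in
theorem commutator_mem_frattini (hG : Nat.card G = p ^ n) (g h : G) : ⁅g, h⁆ ∈ frattini G := by
  refine mem_frattini_iff.2 fun M hM => ?_
  have := normal_of_isCoatom hG hM
  have hi : Nat.card (G ⧸ M) = p := index_eq_of_isCoatom hG hM
  have := isCyclic_of_prime_card hi
  let := IsCyclic.commGroup (α := G ⧸ M)
  rw [← QuotientGroup.eq_one_iff]
  have := mul_comm (g : G ⧸ M) (h : G ⧸ M)
  change ((g * h * g⁻¹ * h⁻¹ : G) : G ⧸ M) = 1
  exact commutatorElement_eq_one_iff_mul_comm.2 this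

/-- A normal subgroup of order `p` of a finite `p`-group is central. -/
theorem le_center_of_card_eq (hG : Nat.card G = p ^ n) {N : Subgroup G} [N.Normal]
    (hN : Nat.card N = p) : N ≤ Subgroup.center G := by
  have hp : p.Prime := Fact.out
  have : Finite G := Nat.finite_of_card_ne_zero (by rw [hG]; exact pow_ne_zero _ hp.ne_zero)
  have hP : IsPGroup p (ConjAct G) := IsPGroup.of_card (G := ConjAct G) hG
  have h1 : (1 : N) ∈ MulAction.fixedPoints (ConjAct G) N := fun g => smul_one g
  obtain ⟨b, hb, hne⟩ := hP.exists_fixed_point_of_prime_dvd_card_of_fixed_point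
    N (by rw [hN]) h1
  have hb' : (b : G) ∈ Subgroup.center G := by
    refine Subgroup.mem_center_iff.2 fun g => ?_
    have := congrArg Subtype.val (hb (ConjAct.toConjAct g))
    rw [ConjAct.Subgroup.val_conj_smul, ConjAct.toConjAct_smul] at this
    exact mul_inv_eq_iff_eq_mul.1 this
  intro x hx
  have hxz : (⟨x, hx⟩ : N) ∈ Subgroup.zpowers b := by
    rw [zpowers_eq_top_of_prime_card hN (fun h => hne h.symm)]; trivial
  obtain ⟨a, ha⟩ := hxz
  have : x = (b : G) ^ a := by simpa using (congrArg Subtype.val ha).symm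
  exact this ▸ Subgroup.zpow_mem _ hb' a

/-- A finite elementary abelian `p`-group has trivial Frattini subgroup. -/
theorem frattini_eq_bot [Finite G] (hcomm : ∀ g h : G, g * h = h * g)
    (hpow : ∀ g : G, g ^ p = 1) : frattini G = ⊥ := by
  have hp : p.Prime := Fact.out
  let : CommGroup G := { ‹Group G› with mul_comm := hcomm }
  rw [eq_bot_iff]
  intro x hx
  by_contra hx1
  obtain ⟨M, hM⟩ := (Set.toFinite {M : Subgroup G | x ∉ M}).exists_maximal
    ⟨⊥, hx1⟩
  have htop : M ⊔ Subgroup.zpowers x = ⊤ := by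
    rw [eq_top_iff]
    intro g _
    by_contra hg
    have hlt : M < M ⊔ Subgroup.zpowers g := lt_of_le_of_ne le_sup_left fun h => hg <|
      Subgroup.mem_sup_left (h ▸ Subgroup.mem_sup_right (Subgroup.mem_zpowers g))
    have hxm : x ∈ M ⊔ Subgroup.zpowers g := by
      by_contra h
      exact hlt.not_ge (hM.2 h hlt.le)
    obtain ⟨m, hm, y, ⟨a, rfl⟩, rfl⟩ := Subgroup.mem_sup.1 hxm
    by_cases hpa : (p : ℤ) ∣ a
    · obtain ⟨b, rfl⟩ := hpa
      apply hM.1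
      simpa [zpow_mul, hpow] using hm
    · have hc : IsCoprime (p : ℤ) a :=
        (Nat.prime_iff_prime_int.1 hp).coprime_iff_not_dvd.2 hpa
      obtain ⟨u, v, huv⟩ := hc
      apply hg
      have : g = (m⁻¹ * (m * g ^ a)) ^ v := by
        rw [inv_mul_cancel_left, ← zpow_mul, mul_comm a v]
        conv_lhs => rw [← zpow_one g, ← huv, zpow_add, mul_comm u, zpow_mul]
        simp [hpow]
      have hmem := Subgroup.zpow_mem (M ⊔ Subgroup.zpowers (m * g ^ a))
        (Subgroup.mul_mem _ (Subgroup.mem_sup_left (inv_mem hm))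
        (Subgroup.mem_sup_right (Subgroup.mem_zpowers _))) v
      rwa [← this] at hmem
  have : M = ⊤ := frattini_nongenerating <| eq_top_iff.2 <| htop ▸
    sup_le_sup_left (Subgroup.zpowers_le.2 hx) M
  exact hM.1 (this ▸ Subgroup.mem_top x)

/-- A subgroup of index dividing `p ^ e` becomes everything on adjoining at most `e` elements. -/
theorem exists_finset_sup_closure_eq_top {e : ℕ} {H : Subgroup G} (hH : H.index ∣ p ^ e) :
    ∃ s : Finset G, s.card ≤ e ∧ H ⊔ Subgroup.closure (s : Set G) = ⊤ := by
  classical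
  have hp : p.Prime := Fact.out
  induction e generalizing H with
  | zero => exact ⟨∅, by simp, by simpa using hH⟩
  | succ e ih =>
    by_cases htop : H = ⊤
    · exact ⟨∅, by simp, by simp [htop]⟩
    obtain ⟨g, hg⟩ : ∃ g, g ∉ H := by
      by_contra! h
      exact htop (eq_top_iff.2 fun x _ => h x)
    have hle : H ≤ H ⊔ Subgroup.zpowers g := le_sup_left
    have hi : (H ⊔ Subgroup.zpowers g).index ∣ p ^ e := by
      have hr := Subgroup.relIndex_mul_index hle
      obtain ⟨a, ha, ha'⟩ := (Nat.dvd_prime_pow hp).1 (hr ▸ hH)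
      obtain ⟨b, hb, hb'⟩ := (Nat.dvd_prime_pow hp).1
        ((Dvd.intro_left _ ha').trans (pow_dvd_pow p ha))
      obtain ⟨c, hc, hc'⟩ := (Nat.dvd_prime_pow hp).1 ((Dvd.intro _ ha').trans (pow_dvd_pow p ha))
      have hc0 : c ≠ 0 := by
        rintro rfl
        rw [pow_zero, Subgroup.relIndex_eq_one] at hc'
        exact hg (hc' (Subgroup.mem_sup_right (Subgroup.mem_zpowers g)))
      rw [hc', hb', ← pow_add] at ha'
      have := Nat.pow_right_injective hp.two_le ha'
      rw [hb']
      exact pow_dvd_pow p (by omega)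
    obtain ⟨s, hs, hst⟩ := ih hi
    refine ⟨insert g s, (Finset.card_insert_le _ _).trans (by omega), ?_⟩
    rw [Finset.coe_insert, Set.insert_eq, Subgroup.closure_union,
      ← Subgroup.zpowers_eq_closure, ← sup_assoc, hst]

end FrattiniPGroup

section RadicalFiltration

variable {A : Type*} [Ring A]

/-- The powers of a two-sided ideal generated as a left ideal by `s` are generated as left ideals
by words in `s`. -/
theorem pow_le_span_words {I : Ideal A} [I.IsTwoSided] {s : Set A} (hI : I ≤ Ideal.span s)
    (m : ℕ) : I ^ m ≤ Ideal.span {a | ∃ l : List A, l.length = m ∧ (∀ x ∈ l, x ∈ s) ∧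
      l.prod = a} := by
  induction m with
  | zero =>
    refine fun a _ => ?_
    rw [← mul_one a]
    exact Ideal.mul_mem_left _ _ (Ideal.subset_span ⟨[], rfl, by simp, rfl⟩)
  | succ m ih =>
    rw [Ideal.IsTwoSided.pow_succ]
    refine Ideal.mul_le.2 fun a ha b hb => ?_
    replace hb := ih hb
    induction hb using Submodule.span_induction generalizing a with
    | zero => simp
    | add x y _ _ hx hy => rw [mul_add]; exact add_mem (hx a ha) (hy a ha)
    | smul c x _ hx =>
      rw [smul_eq_mul, ← mul_assoc]
      exact hx _ (I.mul_mem_right c ha)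
    | mem x hx =>
      obtain ⟨l, hl, hls, rfl⟩ := hx
      replace ha := hI ha
      induction ha using Submodule.span_induction with
      | zero => simp
      | add x y _ _ hx hy => rw [add_mul]; exact add_mem hx hy
      | smul c x _ hx => rw [smul_eq_mul, mul_assoc]; exact Ideal.mul_mem_left _ _ hx
      | mem x hx =>
        exact Ideal.subset_span ⟨x :: l, by simp [hl], by simpa [hx] using hls, by simp⟩

theorem list_prod_mem_pow {I : Ideal A} [I.IsTwoSided] {l : List A} (hl : ∀ x ∈ l, x ∈ I) :
    l.prod ∈ I ^ l.length := by
  induction l with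
  | nil => simp [Submodule.pow_zero]
  | cons x l ih =>
    rw [List.prod_cons, List.length_cons, Ideal.IsTwoSided.pow_succ]
    exact Ideal.mul_mem_mul (hl x (by simp)) (ih fun y hy => hl y (by simp [hy]))

theorem mul_mem_pow_add {I : Ideal A} [I.IsTwoSided] {a b : A} {i j : ℕ} (ha : a ∈ I ^ i)
    (hb : b ∈ I ^ j) : a * b ∈ I ^ (i + j) := by
  rw [Ideal.IsTwoSided.pow_add]
  exact Ideal.mul_mem_mul ha hb

theorem pow_mem_pow_mul {I : Ideal A} [I.IsTwoSided] {a : A} {i : ℕ} (ha : a ∈ I ^ i) (j : ℕ) :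
    a ^ j ∈ I ^ (i * j) := by
  induction j with
  | zero => simp [Submodule.pow_zero]
  | succ j ih => rw [pow_succ, Nat.mul_succ]; exact mul_mem_pow_add ih ha

/-- Reordering a word changes it by a multiple of `z`, if commutators of letters are
multiples of the central element `z`. -/
theorem exists_prod_sub_prod_eq_of_perm {I : Ideal A} [I.IsTwoSided] {s : Set A} (hs : s ⊆ I)
    {z : A} (hz : ∀ a, z * a = a * z) (hcomm : ∀ x ∈ s, ∀ y ∈ s, ∃ c, x * y - y * x = c * z)
    {l l' : List A} (h : l.Perm l') (hl : ∀ x ∈ l, x ∈ s) :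
    ∃ b ∈ I ^ (l.length - 2), l.prod - l'.prod = b * z := by
  induction h with
  | nil => exact ⟨0, zero_mem _, by simp⟩
  | cons x h ih =>
    obtain ⟨b, hb, h⟩ := ih fun y hy => hl y (by simp [hy])
    refine ⟨x * b, ?_, by rw [List.prod_cons, List.prod_cons, ← mul_sub, h, mul_assoc]⟩
    have hx : x ∈ I ^ 1 := by rw [Submodule.pow_one]; exact hs (hl x (by simp))
    refine Ideal.pow_le_pow_right ?_ (mul_mem_pow_add hx hb)
    simp only [List.length_cons]
    omega
  | swap x y l =>
    obtain ⟨c, hc⟩ := hcomm y (hl y (by simp)) x (hl x (by simp))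
    refine ⟨c * l.prod, ?_, ?_⟩
    · exact Ideal.mul_mem_left _ _ (list_prod_mem_pow fun t ht => hs (hl t (by simp [ht])))
    · rw [List.prod_cons, List.prod_cons, List.prod_cons, List.prod_cons, ← mul_assoc, ← mul_assoc,
        ← sub_mul, hc, mul_assoc, mul_assoc, hz]
  | trans h₁ h₂ ih₁ ih₂ =>
    obtain ⟨b, hb, h⟩ := ih₁ hl
    obtain ⟨b', hb', h'⟩ := ih₂ fun y hy => hl y (h₁.mem_iff.2 hy)
    refine ⟨b + b', add_mem hb (h₁.length_eq ▸ hb'), ?_⟩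
    rw [add_mul, ← h, ← h', sub_add_sub_cancel]

theorem exists_perm_replicate_append {α : Type*} [DecidableEq α] {s : Finset α} {q : ℕ}
    {l : List α} (hl : ∀ x ∈ l, x ∈ s) (hlen : s.card * q < l.length) :
    ∃ x ∈ s, ∃ l', l.Perm (List.replicate (q + 1) x ++ l') := by
  obtain ⟨x, hx, hlt⟩ : ∃ x ∈ s, q < l.count x := by
    by_contra! h
    have h1 : ∑ x ∈ s, l.count x = l.length := by
      simpa using Multiset.sum_count_eq_card (s := s) (m := (l : Multiset α)) (by simpa using hl)
    have := Finset.sum_le_card_nsmul s _ q h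
    rw [h1, smul_eq_mul] at this
    omega
  exact ⟨x, hx, (List.replicate_sublist_iff.2 hlt).exists_perm_append⟩

/-- High powers of `I` consist of multiples of `z`. -/
theorem exists_eq_mul_of_mem_pow {I : Ideal A} [I.IsTwoSided] {s : Finset A}
    (hs : (s : Set A) ⊆ I) (hI : I ≤ Ideal.span s) {z : A} (hz : ∀ a, z * a = a * z)
    (hcomm : ∀ x ∈ s, ∀ y ∈ s, ∃ c, x * y - y * x = c * z) {p w m : ℕ} (hp : 0 < p) (hw : 2 ≤ w)
    (hpow : ∀ x ∈ s, x ^ p = 0 ∨ p ≤ w ∧ ∃ c, x ^ p = c * z)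
    (hm : s.card * (p - 1) < m) {a : A} (ha : a ∈ I ^ m) : ∃ b ∈ I ^ (m - w), a = b * z := by
  classical
  replace ha := pow_le_span_words hI m ha
  induction ha using Submodule.span_induction with
  | zero => exact ⟨0, zero_mem _, by simp⟩
  | add x y _ _ hx hy =>
    obtain ⟨b, hb, rfl⟩ := hx
    obtain ⟨c, hc, rfl⟩ := hy
    exact ⟨b + c, add_mem hb hc, by rw [add_mul]⟩
  | smul c x _ hx =>
    obtain ⟨b, hb, rfl⟩ := hx
    exact ⟨c * b, Ideal.mul_mem_left _ _ hb, by rw [smul_eq_mul, mul_assoc]⟩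
  | mem a ha =>
    obtain ⟨l, rfl, hls, rfl⟩ := ha
    obtain ⟨x, hx, l', hperm⟩ := exists_perm_replicate_append hls hm
    obtain ⟨b, hb, h⟩ := exists_prod_sub_prod_eq_of_perm hs hz hcomm hperm hls
    have hlen := hperm.length_eq
    rw [List.length_append, List.length_replicate] at hlen
    rw [List.prod_append, List.prod_replicate, Nat.sub_add_cancel hp] at h
    have hb : b ∈ I ^ (l.length - w) := Ideal.pow_le_pow_right (by omega) hb
    have hl' : l'.prod ∈ I ^ l'.length :=
      list_prod_mem_pow fun y hy => hs (hls y (hperm.mem_iff.2 (by simp [hy])))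
    rcases hpow x hx with h0 | ⟨hpw, c, hc⟩
    · exact ⟨b, hb, by rw [← h, h0, zero_mul, sub_zero]⟩
    · refine ⟨b + c * l'.prod, add_mem hb (Ideal.mul_mem_left _ _ ?_), ?_⟩
      · exact Ideal.pow_le_pow_right (by omega) hl'
      · rw [add_mul, ← h, mul_assoc, ← hz, ← mul_assoc, ← hc, sub_add_cancel]

theorem pow_eq_bot_of_central {I : Ideal A} [I.IsTwoSided] {s : Finset A}
    (hs : (s : Set A) ⊆ I) (hI : I ≤ Ideal.span s) {z : A} (hz : ∀ a, z * a = a * z)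
    (hcomm : ∀ x ∈ s, ∀ y ∈ s, ∃ c, x * y - y * x = c * z) {p w d : ℕ} (hp : 0 < p) (hw : 2 ≤ w)
    (hpow : ∀ x ∈ s, x ^ p = 0 ∨ p ≤ w ∧ ∃ c, x ^ p = c * z)
    (hd : s.card ≤ d) (hzp : z ^ p = 0) : I ^ ((d + w) * (p - 1) + 1) = ⊥ := by
  have key : ∀ j ≤ p, ∀ a ∈ I ^ (d * (p - 1) + 1 + w * j - w), a * z ^ (p - j) = 0 := by
    intro j
    induction j with
    | zero => intro _ a _; simp [hzp]
    | succ j ih =>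
      intro hj a ha
      have hdc : s.card * (p - 1) ≤ d * (p - 1) := Nat.mul_le_mul_right _ hd
      rw [Nat.mul_succ, ← add_assoc, Nat.add_sub_cancel] at ha
      obtain ⟨b, hb, rfl⟩ := exists_eq_mul_of_mem_pow hs hI hz hcomm hp hw hpow
        (lt_of_le_of_lt hdc (by omega)) ha
      rw [mul_assoc, ← pow_succ', show p - (j + 1) + 1 = p - j by omega]
      exact ih (by omega) b hb
  rw [eq_bot_iff]
  intro a ha
  have := key p le_rfl a (by
    convert ha using 2
    obtain ⟨q, rfl⟩ : ∃ q, p = q + 1 := ⟨p - 1, by omega⟩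
    rw [Nat.mul_succ, ← add_assoc, Nat.add_sub_cancel, Nat.add_sub_cancel]
    ring)
  simpa using this

end RadicalFiltration

section Jacobson

variable {A : Type*} [Ring A]

theorem le_ringJacobson_of_pow_eq_bot {I : Ideal A} {m : ℕ} (hI : I ^ m = ⊥) :
    I ≤ Ring.jacobson A := by
  have hpow : ∀ x ∈ I, ∀ m : ℕ, x ^ m ∈ I ^ m := by
    intro x hx m
    induction m with
    | zero => simp [Submodule.pow_zero]
    | succ m ih => rw [pow_succ, Submodule.pow_succ]; exact Ideal.mul_mem_mul ih hx
  intro x hx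
  rw [← Ideal.jacobson_bot, Ideal.mem_jacobson_iff]
  intro y
  have hnil : IsNilpotent (y * x) := by
    refine ⟨m, ?_⟩
    have := hpow _ (I.mul_mem_left y hx) m
    rwa [hI] at this
  obtain ⟨u, hu⟩ := hnil.isUnit_add_one
  refine ⟨(u⁻¹ : Aˣ), ?_⟩
  have : (u⁻¹ : Aˣ) * (y * x + 1) = 1 := by rw [← hu, Units.inv_mul]
  rw [mul_add, mul_one, ← mul_assoc] at this
  simp [this]

theorem radicalNilpotencyIndex_eq {I : Ideal A} [I.IsMaximal] {m : ℕ} (hbot : I ^ (m + 1) = ⊥)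
    (hne : I ^ m ≠ ⊥) [I.IsTwoSided] : radicalNilpotencyIndex A = m + 1 := by
  have hJ : Ring.jacobson A = I :=
    le_antisymm (Ring.jacobson_le_of_isMaximal I) (le_ringJacobson_of_pow_eq_bot hbot)
  unfold radicalNilpotencyIndex
  rw [hJ]
  refine le_antisymm (Nat.sInf_le ⟨Nat.succ_pos m, hbot⟩) ?_
  refine le_csInf ⟨m + 1, Nat.succ_pos m, hbot⟩ fun s hs => ?_
  by_contra! hlt
  exact hne (eq_bot_iff.2 (hs.2 ▸ Ideal.pow_le_pow_right (Nat.lt_succ_iff.1 hlt)))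

end Jacobson

section GroupAlgebra

open MonoidAlgebra

variable (k G : Type*) [Field k] [Group G]

/-- The augmentation ideal of the group algebra `kG`. -/
noncomputable def augmentationIdeal : Ideal (MonoidAlgebra k G) :=
  RingHom.ker (MonoidAlgebra.lift k k G 1)

instance : (augmentationIdeal k G).IsTwoSided :=
  inferInstanceAs (RingHom.ker (MonoidAlgebra.lift k k G 1)).IsTwoSided

instance : (augmentationIdeal k G).IsMaximal :=
  RingHom.ker_isMaximal_of_surjective (MonoidAlgebra.lift k k G 1) fun c =>
    ⟨algebraMap k _ c, by rw [AlgHom.commutes]; rfl⟩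

variable {G}

theorem of_sub_one_mem_augmentationIdeal (g : G) : of k G g - 1 ∈ augmentationIdeal k G := by
  rw [augmentationIdeal, RingHom.mem_ker, map_sub, lift_of, map_one, MonoidHom.one_apply, sub_self]

theorem sub_algebraMap_mem_span (f : MonoidAlgebra k G) :
    f - algebraMap k _ (MonoidAlgebra.lift k k G 1 f) ∈
      Ideal.span (Set.range fun g : G => of k G g - 1) := by
  induction f using MonoidAlgebra.induction_on with
  | of g =>
    rw [lift_of, MonoidHom.one_apply, map_one]
    exact Ideal.subset_span ⟨g, rfl⟩
  | add f g hf hg =>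
    rw [map_add, map_add, add_sub_add_comm]
    exact add_mem hf hg
  | smul r f hf =>
    rw [map_smul, smul_eq_mul, map_mul, Algebra.smul_def, ← mul_sub]
    exact Ideal.mul_mem_left _ _ hf

/-- The augmentation ideal is generated as a left ideal by the `g - 1` with `g` in a generating
set. -/
theorem augmentationIdeal_le_span {s : Set G} (hs : Subgroup.closure s = ⊤) :
    augmentationIdeal k G ≤ Ideal.span ((fun g : G => of k G g - 1) '' s) := by
  have hg : ∀ g : G, of k G g - 1 ∈ Ideal.span ((fun g : G => of k G g - 1) '' s) := by
    intro g
    have hg : g ∈ Subgroup.closure s := hs ▸ Subgroup.mem_top g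
    induction hg using Subgroup.closure_induction with
    | mem x hx => exact Ideal.subset_span ⟨x, hx, rfl⟩
    | one => rw [map_one, sub_self]; exact zero_mem _
    | mul x y _ _ hx hy =>
      have : of k G (x * y) - 1 = of k G x * (of k G y - 1) + (of k G x - 1) := by
        rw [map_mul]; noncomm_ring
      rw [this]
      exact add_mem (Ideal.mul_mem_left _ _ hy) hx
    | inv x _ hx =>
      have : of k G x⁻¹ - 1 = -(of k G x⁻¹ * (of k G x - 1)) := by
        rw [mul_sub, ← map_mul, inv_mul_cancel, map_one]; noncomm_ring
      rw [this]
      exact neg_mem (Ideal.mul_mem_left _ _ hx)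
  intro f hf
  have h := sub_algebraMap_mem_span k f
  rw [augmentationIdeal, RingHom.mem_ker] at hf
  rw [hf, map_zero, sub_zero] at h
  refine (Ideal.span_le.2 ?_) h
  rintro _ ⟨g, rfl⟩
  exact hg g

theorem commute_of_of_mem_center {z : G} (hz : z ∈ Subgroup.center G) (a : MonoidAlgebra k G) :
    of k G z * a = a * of k G z := by
  induction a using MonoidAlgebra.induction_on with
  | of g => rw [← map_mul, ← map_mul, Subgroup.mem_center_iff.1 hz g]
  | add f g hf hg => rw [mul_add, add_mul, hf, hg]
  | smul r f hf => rw [mul_smul_comm, smul_mul_assoc, hf]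

theorem exists_of_sub_one_eq_mul {z y : G} (hy : y ∈ Subgroup.zpowers z) (hz : IsOfFinOrder z) :
    ∃ c, of k G y - 1 = c * (of k G z - 1) := by
  obtain ⟨a, rfl⟩ := (hz.mem_powers_iff_mem_zpowers).2 hy
  exact ⟨∑ i ∈ Finset.range a, of k G z ^ i, by rw [geom_sum_mul, ← map_pow]⟩

variable {p : ℕ} [Fact p.Prime] [CharP k p]

theorem of_sub_one_pow_char (g : G) : (of k G g - 1) ^ p = of k G (g ^ p) - 1 := by
  have : CharP (MonoidAlgebra k G) p := charP_of_injective_algebraMap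
    (algebraMap k (MonoidAlgebra k G)).injective p
  rw [sub_pow_char_of_commute _ (Commute.one_right _), one_pow, map_pow]

theorem sub_one_pow_pred_eq_geom_sum {B : Type*} [Ring B] [Algebra k B] (x : B) :
    (x - 1) ^ (p - 1) = ∑ i ∈ Finset.range p, x ^ i := by
  have hp : p.Prime := Fact.out
  have h : (Polynomial.X - 1 : Polynomial k) ^ (p - 1) =
      ∑ i ∈ Finset.range p, Polynomial.X ^ i := by
    refine mul_right_cancel₀ (b := (Polynomial.X - 1 : Polynomial k))
      (Polynomial.X_sub_C_ne_zero (1 : k)) ?_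
    rw [← pow_succ, Nat.sub_add_cancel hp.pos, geom_sum_mul, sub_pow_char, one_pow]
  simpa using congrArg (Polynomial.aeval x) h

end GroupAlgebra

section SubgroupSum

open MonoidAlgebra

variable (k : Type*) [Field k] {G : Type*} [Group G] [Finite G]

/-- The sum in `kG` of the elements of a subgroup. -/
noncomputable def subgroupSum (H : Subgroup G) : MonoidAlgebra k G :=
  ∑ g ∈ (Set.toFinite (H : Set G)).toFinset, of k G g

theorem subgroupSum_ne_zero (H : Subgroup G) : subgroupSum k H ≠ 0 := by
  intro h
  classical
  have h1 : (subgroupSum k H).coeff 1 = 1 := by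
    simp [subgroupSum, coeff_sum, Finsupp.finsetSum_apply, Finsupp.single_apply, H.one_mem]
  rw [h] at h1
  exact zero_ne_one h1

variable {k} {p : ℕ} [Fact p.Prime]

/-- If `K` has `p` times the order of `H`, then any `g ∈ K` outside `H` with `g ^ p ∈ H` yields
coset representatives `1, g, …, g ^ (p - 1)`. -/
theorem subgroupSum_eq_geom_sum_mul {H K : Subgroup G} (hHK : H ≤ K)
    (hcard : Nat.card K = p * Nat.card H) {g : G} (hgK : g ∈ K) (hgH : g ∉ H)
    (hgp : g ^ p ∈ H) :
    subgroupSum k K = (∑ i ∈ Finset.range p, of k G g ^ i) * subgroupSum k H := by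
  classical
  have hp : p.Prime := Fact.out
  have hcop : ∀ c : ℕ, 0 < c → c < p → g ^ c ∉ H := by
    intro c h0 hc hmem
    have hco : Nat.Coprime p c := Nat.coprime_of_lt_prime h0.ne' hc hp
    apply hgH
    have h := Nat.gcd_eq_gcd_ab p c
    rw [hco] at h
    rw [← zpow_one g]
    have h' : (1 : ℤ) = p * p.gcdA c + c * p.gcdB c := by exact_mod_cast h
    rw [h', zpow_add, zpow_mul, zpow_mul, zpow_natCast, zpow_natCast]
    exact H.mul_mem (H.zpow_mem hgp _) (H.zpow_mem hmem _)
  have hdiff : ∀ a b : ℕ, a < b → b < p → ∀ x ∈ H, ∀ y ∈ H, g ^ a * x ≠ g ^ b * y := by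
    intro a b hab hb x hx y hy h
    apply hcop (b - a) (by omega) (by omega)
    have : g ^ (b - a) = x * y⁻¹ := by
      rw [eq_mul_inv_iff_mul_eq]
      apply mul_left_cancel (a := g ^ a)
      rw [← mul_assoc, ← pow_add, Nat.add_sub_cancel' hab.le, h]
    rw [this]
    exact H.mul_mem hx (H.inv_mem hy)
  let s := (Set.toFinite (H : Set G)).toFinset
  let t := (Set.toFinite (K : Set G)).toFinset
  have hs : s.card = Nat.card H := by
    rw [← Set.ncard_eq_toFinset_card _ _]; rfl
  have ht : t.card = Nat.card K := by
    rw [← Set.ncard_eq_toFinset_card _ _]; rfl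
  have hinj : Set.InjOn (fun q : ℕ × G => g ^ q.1 * q.2) (Finset.range p ×ˢ s : Finset (ℕ × G)) := by
    rintro ⟨a, x⟩ hx ⟨b, y⟩ hy h
    simp only [Finset.coe_product, Set.mem_prod, Finset.mem_range, s,
      Set.Finite.mem_toFinset, SetLike.mem_coe] at hx hy h
    rcases lt_trichotomy a b with hab | rfl | hab
    · exact absurd h (hdiff a b hab hy.1 x hx.2 y hy.2)
    · rw [mul_left_cancel h]
    · exact absurd h.symm (hdiff b a hab hx.1 y hy.2 x hx.2)
  have himg : (Finset.range p ×ˢ s).image (fun q : ℕ × G => g ^ q.1 * q.2) = t := by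
    refine Finset.eq_of_subset_of_card_le ?_ ?_
    · intro x hx
      obtain ⟨⟨a, y⟩, hq, rfl⟩ := Finset.mem_image.1 hx
      rw [Finset.mem_product] at hq
      simp only [s, t, Set.Finite.mem_toFinset, SetLike.mem_coe] at hq ⊢
      exact K.mul_mem (K.pow_mem hgK a) (hHK hq.2)
    · rw [Finset.card_image_of_injOn hinj, Finset.card_product, Finset.card_range, hs, ht, hcard]
  change ∑ x ∈ t, of k G x = _ * ∑ x ∈ s, of k G x
  rw [← himg, Finset.sum_image hinj, Finset.sum_product, Finset.sum_mul_sum]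
  simp only [map_mul, map_pow]

variable [CharP k p] {n : ℕ}

/-- Each subgroup in a chain from `N` upwards with successive indices `p` contributes `p - 1` to the
order of vanishing of the subgroup sum. -/
theorem subgroupSum_mem_pow (hG : Nat.card G = p ^ n) {N : Subgroup G} {m w : ℕ}
    (hN : Nat.card N = p ^ m) (hNp : ∀ g : G, g ^ p ∈ N)
    (hsum : subgroupSum k N ∈ augmentationIdeal k G ^ w) (e : ℕ) (he : m + e ≤ n) :
    ∃ H : Subgroup G, N ≤ H ∧ Nat.card H = p ^ (m + e) ∧
      subgroupSum k H ∈ augmentationIdeal k G ^ (e * (p - 1) + w) := by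
  have hp : p.Prime := Fact.out
  induction e with
  | zero => exact ⟨N, le_rfl, hN, by simpa using hsum⟩
  | succ e ih =>
    obtain ⟨H, hNH, hH, hsH⟩ := ih (by omega)
    obtain ⟨K, hK, hHK⟩ := Sylow.exists_subgroup_card_pow_succ
      (hG ▸ pow_dvd_pow p (show m + e + 1 ≤ n by omega)) hH
    have hlt : H < K := lt_of_le_of_ne hHK fun h => by
      rw [← h, hH] at hK
      exact absurd (Nat.pow_right_injective hp.two_le hK) (by omega)
    obtain ⟨g, hgK, hgH⟩ := SetLike.exists_of_lt hlt
    refine ⟨K, hNH.trans hHK, hK, ?_⟩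
    rw [subgroupSum_eq_geom_sum_mul hHK (by rw [hK, hH, pow_succ, mul_comm]) hgK hgH
      (hNH (hNp g)), ← sub_one_pow_pred_eq_geom_sum k, Nat.succ_mul, add_comm (e * _), add_assoc]
    have h1 : of k G g - 1 ∈ augmentationIdeal k G ^ 1 := by
      rw [Submodule.pow_one]; exact of_sub_one_mem_augmentationIdeal k g
    refine mul_mem_pow_add ?_ hsH
    simpa using pow_mem_pow_mul h1 (p - 1)

theorem augmentationIdeal_pow_ne_bot (hG : Nat.card G = p ^ n) {N : Subgroup G}
    (hN : Nat.card N = p) (hNp : ∀ g : G, g ^ p ∈ N) {z : G} (hz : z ∈ N) (hz1 : z ≠ 1) {w : ℕ}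
    (hzw : of k G z - 1 ∈ augmentationIdeal k G ^ w) :
    augmentationIdeal k G ^ ((n - 1 + w) * (p - 1)) ≠ ⊥ := by
  have hp : p.Prime := Fact.out
  have hn : 1 ≤ n := by
    rcases Nat.eq_zero_or_pos n with rfl | h
    · have := N.card_subgroup_dvd_card
      rw [hN, hG, pow_zero, Nat.dvd_one] at this
      exact absurd this hp.one_lt.ne'
    · exact h
  have hbase : subgroupSum k N ∈ augmentationIdeal k G ^ (w * (p - 1)) := by
    have hzp : z ^ p = 1 := by
      have := pow_card_eq_one' (x := (⟨z, hz⟩ : N))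
      rw [hN] at this
      simpa using congrArg Subtype.val this
    rw [subgroupSum_eq_geom_sum_mul (H := ⊥) (p := p) bot_le (by simp [hN]) hz
      (by simpa using hz1) (by simp [hzp]), ← sub_one_pow_pred_eq_geom_sum k]
    exact Ideal.mul_mem_right _ _ (pow_mem_pow_mul hzw (p - 1))
  obtain ⟨H, -, -, hH⟩ := subgroupSum_mem_pow hG (m := 1) (by rw [hN, pow_one]) hNp hbase (n - 1)
    (by omega)
  intro hbot
  rw [← add_mul, hbot] at hH
  exact subgroupSum_ne_zero k H hH

end SubgroupSum

section NilpotencyIndex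

open MonoidAlgebra

variable (k : Type*) [Field k] {G : Type*} [Group G] {p n : ℕ} [Fact p.Prime] [CharP k p]

/-- If `|Φ(G)| = p` and `Φ(G)` has weight `w` in the augmentation filtration, then
`t(G) = (n - 1 + w)(p - 1) + 1`. -/
theorem groupNilpotencyIndex_eq_of_weight (hG : Nat.card G = p ^ n)
    (hΦ : Nat.card (frattini G) = p) {z : G} (hz : z ∈ frattini G) (hz1 : z ≠ 1) {w : ℕ}
    (hw : 2 ≤ w) (hzw : of k G z - 1 ∈ augmentationIdeal k G ^ w)
    (hpow : ∀ g : G, g ^ p = 1 ∨ p ≤ w) :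
    groupNilpotencyIndex k G = (n - 1 + w) * (p - 1) + 1 := by
  classical
  have hp : p.Prime := Fact.out
  have : Finite G := Nat.finite_of_card_ne_zero (by rw [hG]; exact pow_ne_zero _ hp.ne_zero)
  have hzc : z ∈ Subgroup.center G := le_center_of_card_eq hG hΦ hz
  have hgen : ∀ y ∈ frattini G, ∃ c, of k G y - 1 = c * (of k G z - 1) := by
    intro y hy
    refine exists_of_sub_one_eq_mul k ?_ (isOfFinOrder_of_finite z)
    have h : (⟨y, hy⟩ : frattini G) ∈ Subgroup.zpowers (⟨z, hz⟩ : frattini G) := by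
      rw [zpowers_eq_top_of_prime_card hΦ (by simpa using hz1)]; trivial
    obtain ⟨a, ha⟩ := h
    exact ⟨a, by simpa using congrArg Subtype.val ha⟩
  have hzp : z ^ p = 1 := by
    have := pow_card_eq_one' (x := (⟨z, hz⟩ : frattini G))
    rw [hΦ] at this
    simpa using congrArg Subtype.val this
  have hindex : (frattini G).index ∣ p ^ (n - 1) := by
    have h := (frattini G).card_mul_index
    rw [hΦ, hG] at h
    rcases n with _ | n
    · exact Dvd.intro_left _ h
    · rw [pow_succ'] at h
      exact (Nat.eq_of_mul_eq_mul_left hp.pos h).dvd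
  obtain ⟨s, hs, hst⟩ := exists_finset_sup_closure_eq_top hindex
  have hcl : Subgroup.closure (s : Set G) = ⊤ := frattini_nongenerating (by rw [sup_comm, hst])
  refine radicalNilpotencyIndex_eq (I := augmentationIdeal k G) ?_
    (augmentationIdeal_pow_ne_bot hG hΦ (pow_mem_frattini hG) hz hz1 hzw)
  refine pow_eq_bot_of_central (s := s.image fun g => of k G g - 1) (z := of k G z - 1) ?_ ?_ ?_ ?_
    hp.pos hw ?_ (Finset.card_image_le.trans hs) ?_
  · rw [Finset.coe_image]
    rintro _ ⟨g, -, rfl⟩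
    exact of_sub_one_mem_augmentationIdeal k g
  · rw [Finset.coe_image]
    exact augmentationIdeal_le_span k hcl
  · intro a
    rw [sub_mul, mul_sub, commute_of_of_mem_center k hzc, one_mul, mul_one]
  · intro x hx y hy
    obtain ⟨g, -, rfl⟩ := Finset.mem_image.1 hx
    obtain ⟨h, -, rfl⟩ := Finset.mem_image.1 hy
    obtain ⟨c, hc⟩ := hgen _ (commutator_mem_frattini hG g⁻¹ h⁻¹)
    refine ⟨of k G (h * g) * c, ?_⟩
    rw [mul_assoc, ← hc, mul_sub (of k G (h * g)), ← map_mul, mul_one, commutatorElement_def,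
      show h * g * (g⁻¹ * h⁻¹ * g⁻¹⁻¹ * h⁻¹⁻¹) = g * h by group, map_mul, map_mul]
    noncomm_ring
  · intro x hx
    obtain ⟨g, -, rfl⟩ := Finset.mem_image.1 hx
    rw [of_sub_one_pow_char]
    rcases hpow g with h | h
    · left; rw [h, map_one, sub_self]
    · exact Or.inr ⟨h, hgen _ (pow_mem_frattini hG g)⟩
  · rw [of_sub_one_pow_char, hzp, map_one, sub_self]

open scoped commutatorElement in
theorem commutator_sub_one_mem_pow_two (g h : G) :
    of k G ⁅g, h⁆ - 1 ∈ augmentationIdeal k G ^ 2 := by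
  have key : of k G ⁅g, h⁆ - 1 = ((of k G g - 1) * (of k G h - 1) -
      (of k G h - 1) * (of k G g - 1)) * of k G (g⁻¹ * h⁻¹) := by
    have : (of k G g - 1) * (of k G h - 1) - (of k G h - 1) * (of k G g - 1) =
        of k G (g * h) - of k G (h * g) := by
      rw [map_mul, map_mul]; noncomm_ring
    rw [this, sub_mul, ← map_mul, ← map_mul, commutatorElement_def,
      show h * g * (g⁻¹ * h⁻¹) = 1 by group, map_one, mul_assoc (g * h)]
  have hmem := fun x : G => of_sub_one_mem_augmentationIdeal k x
  rw [key, Submodule.pow_succ, Submodule.pow_one]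
  exact Ideal.mul_mem_right _ _ (sub_mem (Ideal.mul_mem_mul (hmem g) (hmem h))
    (Ideal.mul_mem_mul (hmem h) (hmem g)))

end NilpotencyIndex

theorem lemma4p1 {p n : ℕ} (hp : p.Prime)
    (k : Type*) [Field k] [CharP k p]
    (G : Type*) [Group G] (hG : Nat.card G = p ^ n) (hΦ : Nat.card (frattini G) = p) :
    (Monoid.exponent G = p ∨ Monoid.exponent G = p ^ 2) ∧
    (Monoid.exponent G = p → groupNilpotencyIndex k G = (n + 1) * (p - 1) + 1) ∧
    (Monoid.exponent G = p ^ 2 → groupNilpotencyIndex k G = (p + n - 1) * (p - 1) + 1) ∧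
    (p = 2 → groupNilpotencyIndex k G = n + 2) := by
  have : Fact p.Prime := ⟨hp⟩
  have : Finite G := Nat.finite_of_card_ne_zero (by rw [hG]; exact pow_ne_zero _ hp.ne_zero)
  have hbot : frattini G ≠ ⊥ := fun h => by
    rw [h, Subgroup.card_bot] at hΦ
    exact hp.one_lt.ne hΦ
  have hn : 1 ≤ n := by
    rcases Nat.eq_zero_or_pos n with rfl | h
    · have := (frattini G).card_subgroup_dvd_card
      rw [hΦ, hG, pow_zero, Nat.dvd_one] at this
      exact absurd this hp.one_lt.ne'
    · exact h
  have hexp : Monoid.exponent G = p ∨ Monoid.exponent G = p ^ 2 := by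
    have hdvd : Monoid.exponent G ∣ p ^ 2 := Monoid.exponent_dvd_of_forall_pow_eq_one fun g => by
      have := pow_card_eq_one' (x := (⟨g ^ p, pow_mem_frattini hG g⟩ : frattini G))
      rw [hΦ] at this
      rw [sq, pow_mul]
      simpa using congrArg Subtype.val this
    obtain ⟨a, ha, he⟩ := (Nat.dvd_prime_pow hp).1 hdvd
    interval_cases a
    · rw [pow_zero, Monoid.exp_eq_one_iff] at he
      exact absurd (Subsingleton.elim _ _) hbot
    · left; rw [he, pow_one]
    · exact Or.inr he
  have h1 : Monoid.exponent G = p → groupNilpotencyIndex k G = (n + 1) * (p - 1) + 1 := by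
    intro he
    have hpow : ∀ g : G, g ^ p = 1 := fun g => he ▸ Monoid.pow_exponent_eq_one g
    obtain ⟨g, h, hgh⟩ : ∃ g h : G, g * h ≠ h * g := by
      by_contra! hcomm
      exact hbot (frattini_eq_bot hcomm hpow)
    rw [groupNilpotencyIndex_eq_of_weight k hG hΦ (commutator_mem_frattini hG g h)
      (fun h => hgh (commutatorElement_eq_one_iff_mul_comm.1 h)) le_rfl
      (commutator_sub_one_mem_pow_two k g h) fun g => Or.inl (hpow g),
      show n - 1 + 2 = n + 1 by omega]
  have h2 : Monoid.exponent G = p ^ 2 →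
      groupNilpotencyIndex k G = (p + n - 1) * (p - 1) + 1 := by
    intro he
    obtain ⟨g, hg⟩ : ∃ g : G, g ^ p ≠ 1 := by
      by_contra! hpow
      have := Nat.le_of_dvd hp.pos (Monoid.exponent_dvd_of_forall_pow_eq_one hpow)
      rw [he] at this
      nlinarith [hp.two_le]
    rw [groupNilpotencyIndex_eq_of_weight k hG hΦ (pow_mem_frattini hG g) hg hp.two_le ?_
      fun _ => Or.inr le_rfl, show n - 1 + p = p + n - 1 by omega]
    rw [← of_sub_one_pow_char]
    have h1 : MonoidAlgebra.of k G g - 1 ∈ augmentationIdeal k G ^ 1 := by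
      rw [Submodule.pow_one]; exact of_sub_one_mem_augmentationIdeal k g
    simpa using pow_mem_pow_mul h1 p
  refine ⟨hexp, h1, h2, ?_⟩
  rintro rfl
  rcases hexp with he | he
  · rw [h1 he]; omega
  · rw [h2 he]; omega
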